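/- Let $F,\beta:\mathbb R^3\to(0,\infty)$ and $f:\mathbb R^2\to(0,\infty)$ be smooth functions, let $a_3\in\mathbb R$, and put $h_0=F^{-2}(dx^2+dy^2+dz^2)$, $h=\beta^{-2}h_0$ on $\mathbb R^3$ and $\varphi:\mathbb R^2\to\mathbb R^3$, $\varphi(x,y)=(x,y,a_3)$. Then $\varphi:(\mathbb R^2,f^{-1}\varphi^*h)\to(\mathbb R^3,h)$ is a conformal immersion with conformal factor $\lambda=f^{1/2}$, that is, $\varphi^*h=\lambda^2\,(f^{-1}\varphi^*h)$. It is proper biharmonic (its bitension field $$\tau_2(\varphi)=\mathrm{Trace}(\nabla^{\varphi}\nabla^{\varphi}-\nabla^{\varphi}_{\nabla})\tau(\varphi)-\mathrm{Trace}\,R^{h}(d\varphi,\tau(\varphi))d\varphi$$ vanishes identically, where $R^h(X,Y)Z=[\nabla_X,\nabla_Y]Z-\nabla_{[X,Y]}Z$, while its tension field $\tau(\varphi)=\mathrm{Trace}\,\nabla d\varphi$ does not vanish identically; both traces are taken with respect to $f^{-1}\varphi^*h$) if and only if both of the following hold: (1) at every point of the plane $z=a_3$, $$F\beta(F\beta)_{xx}-2((F\beta)_x)^2+F\beta(F\beta)_{yy}-2((F\beta)_y)^2+2F\beta(F\beta)_{zz}-4((F\beta)_z)^2=0;$$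 (2) $(F\beta)_z$ has no zero on the plane $z=a_3$, and there is a constant $c>0$ with $$f=\frac{c}{|(F\beta)_z|}\circ\varphi .$$ Moreover, $\xi=(F\beta)\frac{\partial}{\partial z}$ is a unit normal vector field of the surface $(\mathbb R^2,\varphi^*h)$ in $(\mathbb R^3,h)$, the mean curvature of the surface with respect to $\xi$ is $H=(F\beta)_z\circ\varphi$, and its mean curvature vector (half the trace of the second fundamental form) is $H\xi$. -/

import Mathlib

open scoped ContDiff

/-! Riemannian geometry of maps between coordinate spaces `ℝᵐ = (Fin m → ℝ)`. All objects are given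
by their components in the standard global coordinates. -/

/-- The partial derivative `∂ᵢ f` at `x`. -/
noncomputable def pd {n : ℕ} (i : Fin n) (f : (Fin n → ℝ) → ℝ) (x : Fin n → ℝ) : ℝ :=
  fderiv ℝ f x (Pi.single i 1)

/-- A field of `n × n` matrices on `ℝⁿ`, read as the components `g_{ij}` of a `(0,2)`-tensor. -/
abbrev MetricField (n : ℕ) : Type := (Fin n → ℝ) → Matrix (Fin n) (Fin n) ℝ

/-- `g` is a smooth Riemannian metric on `ℝⁿ`. -/
structure IsRiemannian {n : ℕ} (g : MetricField n) : Prop where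
  smooth : ∀ i j, ContDiff ℝ ∞ (fun x => g x i j)
  posDef : ∀ x, (g x).PosDef

/-- The Euclidean metric. -/
def euclideanMetric (n : ℕ) : MetricField n := fun _ => 1

/-- The inner product `g_x(v, w)`. -/
def metricInner {n : ℕ} (g : MetricField n) (x v w : Fin n → ℝ) : ℝ :=
  ∑ i, ∑ j, g x i j * v i * w j

/-- The Christoffel symbol `Γᵏᵢⱼ` of the Levi-Civita connection of `g`. -/
noncomputable def christoffel {n : ℕ} (g : MetricField n) (k i j : Fin n) (x : Fin n → ℝ) : ℝ :=
  (1 / 2) * ∑ l, (g x)⁻¹ k l *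
    (pd i (fun y => g y j l) x + pd j (fun y => g y i l) x - pd l (fun y => g y i j) x)

/-- The component along `∂_d` of `R(∂_a, ∂_b)∂_c`, for the curvature tensor
`R(X, Y)Z = ∇_X ∇_Y Z - ∇_Y ∇_X Z - ∇_[X,Y] Z` of `g`. -/
noncomputable def curvatureComponent {n : ℕ} (g : MetricField n) (a b c d : Fin n)
    (x : Fin n → ℝ) : ℝ :=
  pd a (christoffel g d b c) x - pd b (christoffel g d a c) x
    + ∑ e, (christoffel g d a e x * christoffel g e b c x
      - christoffel g d b e x * christoffel g e a c x)

/-- `R(X, Y)Z` at the point `x`. -/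
noncomputable def curvature {n : ℕ} (g : MetricField n) (x X Y Z : Fin n → ℝ) : Fin n → ℝ :=
  fun d => ∑ a, ∑ b, ∑ c, curvatureComponent g a b c d x * X a * Y b * Z c

/-- The vector field `dφ(∂ᵢ)` along `φ`. -/
noncomputable def pushBasis {m n : ℕ} (φ : (Fin m → ℝ) → (Fin n → ℝ)) (i : Fin m) :
    (Fin m → ℝ) → (Fin n → ℝ) :=
  fun x a => pd i (fun y => φ y a) x

/-- The pull-back metric `φ^* h`. -/
noncomputable def pullbackMetric {m n : ℕ} (φ : (Fin m → ℝ) → (Fin n → ℝ)) (h : MetricField n) :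
    MetricField m :=
  fun x => Matrix.of fun i j => metricInner h (φ x) (pushBasis φ i x) (pushBasis φ j x)

/-- The covariant derivative `∇^φ_{∂ᵢ} V` of a vector field `V` along `φ`, for the connection on
`φ⁻¹ T ℝⁿ` induced by the Levi-Civita connection of `h`. -/
noncomputable def covDerivAlong {m n : ℕ} (h : MetricField n) (φ : (Fin m → ℝ) → (Fin n → ℝ))
    (i : Fin m) (V : (Fin m → ℝ) → (Fin n → ℝ)) : (Fin m → ℝ) → (Fin n → ℝ) :=
  fun x a => pd i (fun y => V y a) x
    + ∑ b, ∑ c, christoffel h a b c (φ x) * pushBasis φ i x b * V x c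

/-- The second fundamental form of the map, `∇dφ(∂ᵢ, ∂ⱼ) = ∇^φ_{∂ᵢ} dφ(∂ⱼ) - dφ(∇_{∂ᵢ} ∂ⱼ)`. -/
noncomputable def mapHessian {m n : ℕ} (g : MetricField m) (h : MetricField n)
    (φ : (Fin m → ℝ) → (Fin n → ℝ)) (i j : Fin m) (x : Fin m → ℝ) : Fin n → ℝ :=
  covDerivAlong h φ i (pushBasis φ j) x - ∑ k, christoffel g k i j x • pushBasis φ k x

/-- The tension field `τ(φ) = Tr_g ∇dφ` of `φ : (ℝᵐ, g) → (ℝⁿ, h)`. -/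
noncomputable def tension {m n : ℕ} (g : MetricField m) (h : MetricField n)
    (φ : (Fin m → ℝ) → (Fin n → ℝ)) (x : Fin m → ℝ) : Fin n → ℝ :=
  ∑ i, ∑ j, (g x)⁻¹ i j • mapHessian g h φ i j x

/-- The bitension field
`τ₂(φ) = Tr_g (∇^φ ∇^φ - ∇^φ_{∇}) τ(φ) - Tr_g R(dφ, τ(φ)) dφ` of `φ : (ℝᵐ, g) → (ℝⁿ, h)`. -/
noncomputable def bitension {m n : ℕ} (g : MetricField m) (h : MetricField n)
    (φ : (Fin m → ℝ) → (Fin n → ℝ)) (x : Fin m → ℝ) : Fin n → ℝ :=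
  ∑ i, ∑ j, (g x)⁻¹ i j •
    (covDerivAlong h φ i (covDerivAlong h φ j (tension g h φ)) x
      - ∑ k, christoffel g k i j x • covDerivAlong h φ k (tension g h φ) x
      - curvature h (φ x) (pushBasis φ i x) (tension g h φ x) (pushBasis φ j x))

/-- `φ : (ℝᵐ, g) → (ℝⁿ, h)` is a harmonic map. -/
def IsHarmonicMap {m n : ℕ} (g : MetricField m) (h : MetricField n)
    (φ : (Fin m → ℝ) → (Fin n → ℝ)) : Prop :=
  ContDiff ℝ ∞ φ ∧ ∀ x, tension g h φ x = 0

/-- `φ : (ℝᵐ, g) → (ℝⁿ, h)` is a biharmonic map. -/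
def IsBiharmonicMap {m n : ℕ} (g : MetricField m) (h : MetricField n)
    (φ : (Fin m → ℝ) → (Fin n → ℝ)) : Prop :=
  ContDiff ℝ ∞ φ ∧ ∀ x, bitension g h φ x = 0

/-- A proper biharmonic map is a biharmonic map that is not harmonic. -/
def IsProperBiharmonicMap {m n : ℕ} (g : MetricField m) (h : MetricField n)
    (φ : (Fin m → ℝ) → (Fin n → ℝ)) : Prop :=
  IsBiharmonicMap g h φ ∧ ¬ IsHarmonicMap g h φ

/-- `φ : (ℝᵐ, g) → (ℝⁿ, h)` is a conformal immersion between Riemannian manifolds with conformal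
factor `lam`, that is, `φ^* h = lam² g`. -/
structure IsConformalImmersion {m n : ℕ} (g : MetricField m) (h : MetricField n)
    (φ : (Fin m → ℝ) → (Fin n → ℝ)) (lam : (Fin m → ℝ) → ℝ) : Prop where
  riemannian_source : IsRiemannian g
  riemannian_target : IsRiemannian h
  smooth : ContDiff ℝ ∞ φ
  immersion : ∀ x, Function.Injective (fderiv ℝ φ x)
  factor_pos : ∀ x, 0 < lam x
  conformal : ∀ x, pullbackMetric φ h x = lam x ^ 2 • g x

/-- `ξ` is a unit normal vector field along `φ` in `(ℝⁿ, h)`. -/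
structure IsUnitNormal {m n : ℕ} (h : MetricField n) (φ ξ : (Fin m → ℝ) → (Fin n → ℝ)) : Prop where
  smooth : ContDiff ℝ ∞ ξ
  normal : ∀ x i, metricInner h (φ x) (ξ x) (pushBasis φ i x) = 0
  unit : ∀ x, metricInner h (φ x) (ξ x) (ξ x) = 1

/-- The mean curvature vector `η = (1/m) Tr_g B` of the immersed submanifold `φ(ℝᵐ)` of `(ℝⁿ, h)`,
where `g = φ^* h` is the induced metric and `B` is the second fundamental form. -/
noncomputable def meanCurvatureVector {m n : ℕ} (h : MetricField n)
    (φ : (Fin m → ℝ) → (Fin n → ℝ)) (x : Fin m → ℝ) : Fin n → ℝ :=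
  (1 / (m : ℝ)) • ∑ i, ∑ j,
    (pullbackMetric φ h x)⁻¹ i j • mapHessian (pullbackMetric φ h) h φ i j x

/-- The mean curvature `H = h(η, ξ)` with respect to the unit normal field `ξ`. -/
noncomputable def meanCurvature {m n : ℕ} (h : MetricField n)
    (φ ξ : (Fin m → ℝ) → (Fin n → ℝ)) (x : Fin m → ℝ) : ℝ :=
  metricInner h (φ x) (meanCurvatureVector h φ x) (ξ x)

/-- The rescaled metric `ρ⁻² g`. -/
noncomputable def rescaleMetric {n : ℕ} (ρ : (Fin n → ℝ) → ℝ) (g : MetricField n) :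
    MetricField n :=
  fun x => (ρ x ^ 2)⁻¹ • g x

/-- The map `(x, y) ↦ (x, y, a)` from `ℝ²` to `ℝ³`. -/
def planeMap (a : ℝ) (p : Fin 2 → ℝ) : Fin 3 → ℝ := ![p 0, p 1, a]

/-! Put `u = F β`, so that `h = u⁻² δ` is conformally flat and the plane is totally umbilic: its
unit normal `ξ = u ∂_z` satisfies `∇ᵢ ξ = -H ∂ᵢ` with `H = u_z`. The source metric is a multiple
of the Euclidean one, and in dimension two the traces of its Christoffel symbols vanish. Hence
`τ(φ) = S ξ` with `S = 2 f H`, and, up to a positive factor, the bitension field is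
`(Δ S + S P / u²) ξ - 2 H ∑ₖ (∂ₖ S) ∂ₖ`, where `Δ` is the flat Laplacian and
`P = Ric(ξ, ξ) - |A|²`. The tangential part makes `S ∂ₖ S = 0`, so `S²` is constant; this constant
is nonzero for a proper biharmonic map, and then the normal part reduces to `P = 0`, which is (1),
while constancy of `|S| = 2 f |H|` is (2). -/

section PartialDerivatives

variable {n : ℕ} {f g : (Fin n → ℝ) → ℝ} {x : Fin n → ℝ}

lemma pd_const (i : Fin n) (c : ℝ) (x : Fin n → ℝ) : pd i (fun _ => c) x = 0 := by
  simp [pd]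

lemma pd_sub (i : Fin n) (hf : DifferentiableAt ℝ f x) (hg : DifferentiableAt ℝ g x) :
    pd i (fun y => f y - g y) x = pd i f x - pd i g x := by
  simp [pd, fderiv_fun_sub hf hg]

lemma pd_mul (i : Fin n) (hf : DifferentiableAt ℝ f x) (hg : DifferentiableAt ℝ g x) :
    pd i (fun y => f y * g y) x = pd i f x * g x + f x * pd i g x := by
  simp only [pd, fderiv_fun_mul hf hg, add_apply, smul_apply, smul_eq_mul]
  ring

lemma pd_comp_of_hasDerivAt {G : ℝ → ℝ} {G' : ℝ} (i : Fin n) (hG : HasDerivAt G G' (f x))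
    (hf : DifferentiableAt ℝ f x) : pd i (fun y => G (f y)) x = G' * pd i f x := by
  have hcomp : HasFDerivAt (fun y => G (f y)) (G' • fderiv ℝ f x) x :=
    hG.comp_hasFDerivAt x hf.hasFDerivAt
  simp [pd, hcomp.fderiv]

lemma pd_div (i : Fin n) (hf : DifferentiableAt ℝ f x) (hg : DifferentiableAt ℝ g x)
    (hx : g x ≠ 0) :
    pd i (fun y => f y / g y) x = pd i f x / g x - f x * pd i g x / g x ^ 2 := by
  simp only [div_eq_mul_inv (f _)]
  rw [pd_mul i hf (hg.fun_inv hx), pd_comp_of_hasDerivAt i (hasDerivAt_inv hx) hg]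
  ring

lemma contDiff_pd (i : Fin n) (hf : ContDiff ℝ ∞ f) : ContDiff ℝ ∞ (pd i f) :=
  (hf.fderiv_right (m := ∞) (by simp)).clm_apply contDiff_const

lemma differentiable_pd (i : Fin n) (hf : ContDiff ℝ ∞ f) : Differentiable ℝ (pd i f) :=
  (contDiff_pd i hf).differentiable (by simp)

lemma pd_pd_eq_fderiv_fderiv (hf : ContDiff ℝ ∞ f) (i j : Fin n) :
    pd i (pd j f) x = fderiv ℝ (fderiv ℝ f) x (Pi.single i 1) (Pi.single j 1) := by
  have hf' : DifferentiableAt ℝ (fderiv ℝ f) x :=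
    (hf.fderiv_right (m := ∞) (by simp)).differentiable (by simp) x
  change fderiv ℝ (fun y => fderiv ℝ f y (Pi.single j 1)) x (Pi.single i 1) = _
  simp [fderiv_clm_apply hf' (differentiableAt_const _)]

lemma pd_comm (hf : ContDiff ℝ ∞ f) (i j : Fin n) : pd i (pd j f) x = pd j (pd i f) x := by
  have hsymm : IsSymmSndFDerivAt ℝ f x :=
    hf.contDiffAt.isSymmSndFDerivAt (by
      rw [minSmoothness_of_isRCLikeNormedField]
      exact WithTop.coe_le_coe.2 le_top)
  rw [pd_pd_eq_fderiv_fderiv hf, pd_pd_eq_fderiv_fderiv hf, hsymm.eq]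

lemma eq_of_pd_eq_zero (hf : Differentiable ℝ f) (h : ∀ i x, pd i f x = 0) (x y : Fin n → ℝ) :
    f x = f y := by
  refine is_const_of_fderiv_eq_zero hf (fun z => ?_) x y
  refine ContinuousLinearMap.coe_injective ((Pi.basisFun ℝ (Fin n)).ext fun i => ?_)
  simpa [pd] using h i z

lemma exists_abs_eq_const_iff (hf : Differentiable ℝ f) :
    (∃ c : ℝ, 0 < c ∧ ∀ x, |f x| = c) ↔ (∀ i x, f x * pd i f x = 0) ∧ ∃ x, f x ≠ 0 := by
  have pd_sq : ∀ i x, pd i (fun y => f y ^ 2) x = 2 * (f x * pd i f x) := fun i x => by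
    rw [pd_comp_of_hasDerivAt i (hasDerivAt_pow 2 (f x)) (hf x)]
    norm_num [mul_assoc]
  constructor
  · rintro ⟨c, hc, habs⟩
    refine ⟨fun i x => ?_, 0, abs_pos.1 (habs 0 ▸ hc)⟩
    have hsq : (fun y => f y ^ 2) = fun _ => c ^ 2 := funext fun y => by rw [← habs y, sq_abs]
    simpa [hsq, pd_const] using (pd_sq i x).symm
  · rintro ⟨hgrad, x₀, hx₀⟩
    refine ⟨|f x₀|, abs_pos.2 hx₀, fun x => (sq_eq_sq_iff_abs_eq_abs _ _).1 ?_⟩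
    exact eq_of_pd_eq_zero (hf.pow 2) (fun i y => (pd_sq i y).trans (by rw [hgrad, mul_zero])) x x₀

lemma forall_sum_pd_pd_add_mul_eq_zero_and_exists_ne_zero_iff (hf : ContDiff ℝ ∞ f)
    (V : (Fin n → ℝ) → ℝ) :
    (∀ x, ∑ i, pd i (pd i f) x + f x * V x = 0 ∧ ∀ i, f x * pd i f x = 0) ∧ (∃ x, f x ≠ 0) ↔
      (∀ x, V x = 0) ∧ ∃ c : ℝ, 0 < c ∧ ∀ x, |f x| = c := by
  have habs_iff := exists_abs_eq_const_iff (hf.differentiable (by simp))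
  have ne_zero_of_abs : (∃ c : ℝ, 0 < c ∧ ∀ x, |f x| = c) → ∀ x, f x ≠ 0 := by
    rintro ⟨c, hc, habs⟩ x
    exact abs_pos.1 (habs x ▸ hc)
  have laplacian_eq_zero (hgrad : ∀ i x, f x * pd i f x = 0) (hne : ∀ x, f x ≠ 0) (x) :
      ∑ i, pd i (pd i f) x = 0 := by
    have hpd : ∀ i, pd i f = fun _ => 0 := fun i => funext fun y =>
      (mul_eq_zero.1 (hgrad i y)).resolve_left (hne y)
    simp only [hpd, pd_const, Finset.sum_const_zero]
  constructor
  · rintro ⟨heq, hex⟩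
    have hgrad : ∀ i x, f x * pd i f x = 0 := fun i x => (heq x).2 i
    have habs := habs_iff.2 ⟨hgrad, hex⟩
    refine ⟨fun x => ?_, habs⟩
    have hx := (heq x).1
    rw [laplacian_eq_zero hgrad (ne_zero_of_abs habs), zero_add] at hx
    exact (mul_eq_zero.1 hx).resolve_left (ne_zero_of_abs habs x)
  · rintro ⟨hV, habs⟩
    obtain ⟨hgrad, hex⟩ := habs_iff.1 habs
    refine ⟨fun x => ⟨?_, fun i => hgrad i x⟩, hex⟩
    rw [laplacian_eq_zero hgrad (ne_zero_of_abs habs), hV, mul_zero, add_zero]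

lemma pushBasis_eq_fderiv {m : ℕ} {φ : (Fin m → ℝ) → (Fin n → ℝ)} {p : Fin m → ℝ}
    (hφ : DifferentiableAt ℝ φ p) (i : Fin m) :
    pushBasis φ i p = fderiv ℝ φ p (Pi.single i 1) := by
  funext k
  rw [pushBasis, pd, fderiv_apply hφ k]
  rfl

end PartialDerivatives

section VectorFieldsAlongMaps

variable {m n : ℕ} {h : MetricField n} {φ : (Fin m → ℝ) → (Fin n → ℝ)}
  {V W : (Fin m → ℝ) → (Fin n → ℝ)} {S : (Fin m → ℝ) → ℝ} {x : Fin m → ℝ}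

lemma covDerivAlong_sub (i : Fin m) (hV : DifferentiableAt ℝ V x) (hW : DifferentiableAt ℝ W x) :
    covDerivAlong h φ i (fun y => V y - W y) x =
      covDerivAlong h φ i V x - covDerivAlong h φ i W x := by
  funext k
  simp only [covDerivAlong, Pi.sub_apply, mul_sub, Finset.sum_sub_distrib,
    pd_sub i (differentiableAt_pi.1 hV k) (differentiableAt_pi.1 hW k)]
  ring

lemma covDerivAlong_smul (i : Fin m) (hS : DifferentiableAt ℝ S x)
    (hV : DifferentiableAt ℝ V x) :
    covDerivAlong h φ i (fun y => S y • V y) x =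
      pd i S x • V x + S x • covDerivAlong h φ i V x := by
  funext k
  simp only [covDerivAlong, Pi.smul_apply, Pi.add_apply, smul_eq_mul,
    pd_mul i hS (differentiableAt_pi.1 hV k), mul_add, Finset.mul_sum, mul_left_comm, add_assoc]

lemma curvature_smul_middle (g : MetricField n) (x X Y Z : Fin n → ℝ) (t : ℝ) :
    curvature g x X (t • Y) Z = t • curvature g x X Y Z := by
  funext d
  simp only [curvature, Pi.smul_apply, smul_eq_mul, Finset.mul_sum]
  exact Finset.sum_congr rfl fun a _ => Finset.sum_congr rfl fun b _ =>
    Finset.sum_congr rfl fun c _ => by ring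

lemma curvature_single (g : MetricField n) (x : Fin n → ℝ) (a b c : Fin n) :
    curvature g x (Pi.single a 1) (Pi.single b 1) (Pi.single c 1) =
      fun d => curvatureComponent g a b c d x := by
  funext d
  simp [curvature, Pi.single_apply]

end VectorFieldsAlongMaps

section ConformallyFlat

/-- The conformally flat metric `u⁻² (dx₁² + ⋯ + dxₙ²)` on `ℝⁿ`. -/
noncomputable def conformallyFlatMetric {n : ℕ} (u : (Fin n → ℝ) → ℝ) : MetricField n :=
  rescaleMetric u (euclideanMetric n)

variable {n : ℕ} {u : (Fin n → ℝ) → ℝ} {x : Fin n → ℝ}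

lemma rescaleMetric_rescaleMetric_euclideanMetric (β F : (Fin n → ℝ) → ℝ) :
    rescaleMetric β (rescaleMetric F (euclideanMetric n)) =
      conformallyFlatMetric fun q => F q * β q := by
  funext x
  simp [conformallyFlatMetric, rescaleMetric, smul_smul, mul_pow]

lemma conformallyFlatMetric_apply (u : (Fin n → ℝ) → ℝ) (x : Fin n → ℝ) (i j : Fin n) :
    conformallyFlatMetric u x i j = if i = j then (u x ^ 2)⁻¹ else 0 := by
  simp [conformallyFlatMetric, rescaleMetric, euclideanMetric, Matrix.one_apply]

lemma conformallyFlatMetric_inv_apply (hx : u x ≠ 0) (i j : Fin n) :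
    (conformallyFlatMetric u x)⁻¹ i j = if i = j then u x ^ 2 else 0 := by
  have hinv : (conformallyFlatMetric u x)⁻¹ = (u x ^ 2) • 1 := by
    refine Matrix.inv_eq_left_inv ?_
    simp [conformallyFlatMetric, rescaleMetric, euclideanMetric, smul_smul, hx]
  simp [hinv, Matrix.one_apply]

lemma isRiemannian_conformallyFlatMetric (hu : ContDiff ℝ ∞ u) (hpos : ∀ x, 0 < u x) :
    IsRiemannian (conformallyFlatMetric u) where
  smooth i j := by
    simp only [conformallyFlatMetric_apply]
    split_ifs
    · exact (hu.pow 2).inv fun x => (pow_pos (hpos x) 2).ne'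
    · exact contDiff_const
  posDef x := Matrix.PosDef.one.smul (inv_pos.2 (pow_pos (hpos x) 2))

lemma metricInner_conformallyFlatMetric (u : (Fin n → ℝ) → ℝ) (x v w : Fin n → ℝ) :
    metricInner (conformallyFlatMetric u) x v w = (u x ^ 2)⁻¹ * ∑ i, v i * w i := by
  simp [metricInner, conformallyFlatMetric_apply, Finset.mul_sum, mul_assoc]

lemma pd_conformallyFlatMetric (hu : DifferentiableAt ℝ u x) (hx : u x ≠ 0) (l i j : Fin n) :
    pd l (fun y => conformallyFlatMetric u y i j) x =
      if i = j then -2 * pd l u x / u x ^ 3 else 0 := by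
  simp only [conformallyFlatMetric_apply]
  split_ifs
  · rw [pd_comp_of_hasDerivAt l ((hasDerivAt_pow 2 (u x)).fun_inv (pow_ne_zero 2 hx)) hu]
    push_cast
    field_simp
  · exact pd_const l 0 x

lemma christoffel_conformallyFlatMetric (hu : DifferentiableAt ℝ u x) (hx : u x ≠ 0)
    (k i j : Fin n) :
    christoffel (conformallyFlatMetric u) k i j x =
      ((if i = j then pd k u x else 0) - (if k = i then pd j u x else 0)
        - (if k = j then pd i u x else 0)) / u x := by
  simp only [christoffel, conformallyFlatMetric_inv_apply hx, pd_conformallyFlatMetric hu hx,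
    ite_mul, zero_mul, Finset.sum_ite_eq, Finset.mem_univ, if_true, eq_comm (b := k)]
  split_ifs <;> field_simp <;> ring

lemma sum_christoffel_conformallyFlatMetric (hu : DifferentiableAt ℝ u x) (hx : u x ≠ 0)
    (k : Fin n) :
    ∑ i, christoffel (conformallyFlatMetric u) k i i x = (n - 2) * pd k u x / u x := by
  simp only [christoffel_conformallyFlatMetric hu hx, ← Finset.sum_div, Finset.sum_sub_distrib,
    if_true, Finset.sum_const, Finset.card_univ, Fintype.card_fin, nsmul_eq_mul,
    Finset.sum_ite_eq, Finset.mem_univ]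
  ring

lemma sum_christoffel_mul_christoffel_conformallyFlatMetric (hu : DifferentiableAt ℝ u x)
    (hx : u x ≠ 0) (a b c d : Fin n) :
    ∑ e, christoffel (conformallyFlatMetric u) d a e x *
        christoffel (conformallyFlatMetric u) e b c x =
      ((if d = a then 2 * (pd b u x * pd c u x) else 0)
        - (if d = a then if b = c then ∑ e, pd e u x ^ 2 else 0 else 0)
        - (if a = b then pd c u x * pd d u x else 0)
        - (if a = c then pd b u x * pd d u x else 0)
        + (if d = b then pd a u x * pd c u x else 0)
        + (if d = c then pd a u x * pd b u x else 0)) / u x ^ 2 := by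
  simp only [christoffel_conformallyFlatMetric hu hx, div_mul_div_comm, ← Finset.sum_div, ← sq]
  congr 1
  simp only [sub_mul, mul_sub, Finset.sum_sub_distrib, ite_mul, mul_ite, zero_mul, mul_zero,
    Finset.sum_ite_eq', Finset.mem_univ, if_true]
  simp only [← sq, Finset.sum_ite_irrel, Finset.sum_sub_distrib, Finset.sum_ite_eq,
    Finset.mem_univ, if_true, Finset.sum_const_zero]
  split_ifs <;> ring

lemma pd_christoffel_conformallyFlatMetric (hu : ContDiff ℝ ∞ u) (h0 : ∀ y, u y ≠ 0)
    (l k i j : Fin n) :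
    pd l (christoffel (conformallyFlatMetric u) k i j) x =
      ((if i = j then pd l (pd k u) x else 0) - (if k = i then pd l (pd j u) x else 0)
        - (if k = j then pd l (pd i u) x else 0)) / u x
      - ((if i = j then pd k u x else 0) - (if k = i then pd j u x else 0)
        - (if k = j then pd i u x else 0)) * pd l u x / u x ^ 2 := by
  have hd : Differentiable ℝ u := hu.differentiable (by simp)
  have hite : ∀ (P : Prop) [Decidable P] (r : Fin n),
      DifferentiableAt ℝ (fun y => if P then pd r u y else 0) x ∧
        pd l (fun y => if P then pd r u y else 0) x = if P then pd l (pd r u) x else 0 := by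
    intro P _ r
    split_ifs
    · exact ⟨differentiable_pd r hu x, rfl⟩
    · exact ⟨differentiableAt_const 0, pd_const l 0 x⟩
  rw [funext fun y => christoffel_conformallyFlatMetric (hd y) (h0 y) k i j,
    pd_div l (((hite _ _).1.fun_sub (hite _ _).1).fun_sub (hite _ _).1) (hd x) (h0 x),
    pd_sub l ((hite _ _).1.fun_sub (hite _ _).1) (hite _ _).1,
    pd_sub l (hite _ _).1 (hite _ _).1, (hite _ _).2, (hite _ _).2, (hite _ _).2]

lemma curvatureComponent_conformallyFlatMetric (hu : ContDiff ℝ ∞ u) (h0 : ∀ y, u y ≠ 0)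
    (a b c d : Fin n) :
    curvatureComponent (conformallyFlatMetric u) a b c d x =
      ((if b = c then pd a (pd d u) x else 0) - (if a = c then pd b (pd d u) x else 0)
        - (if d = b then pd a (pd c u) x else 0) + (if d = a then pd b (pd c u) x else 0)) / u x
      - ((if d = a then if b = c then ∑ e, pd e u x ^ 2 else 0 else 0)
        - (if d = b then if a = c then ∑ e, pd e u x ^ 2 else 0 else 0)) / u x ^ 2 := by
  have hd : DifferentiableAt ℝ u x := hu.differentiable (by simp) x
  simp only [curvatureComponent, pd_christoffel_conformallyFlatMetric hu h0,
    Finset.sum_sub_distrib, sum_christoffel_mul_christoffel_conformallyFlatMetric hd (h0 x),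
    pd_comm hu b a, eq_comm (a := b) (b := a)]
  split_ifs <;> ring

end ConformallyFlat

section ConformallyFlatSource

variable {m n : ℕ} {h : MetricField n} {φ : (Fin m → ℝ) → (Fin n → ℝ)} {ρ : (Fin m → ℝ) → ℝ}
  {x : Fin m → ℝ}

lemma trace_sub_christoffel_conformallyFlatMetric (hρ : DifferentiableAt ℝ ρ x) (hx : ρ x ≠ 0)
    (B : Fin m → Fin m → Fin n → ℝ) (D : Fin m → Fin n → ℝ) :
    ∑ i, ∑ j, (conformallyFlatMetric ρ x)⁻¹ i j •
        (B i j - ∑ k, christoffel (conformallyFlatMetric ρ) k i j x • D k) =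
      ρ x ^ 2 • (∑ i, B i i - ∑ k, ((m - 2) * pd k ρ x / ρ x) • D k) := by
  simp only [conformallyFlatMetric_inv_apply hx, ite_smul, zero_smul, Finset.sum_ite_eq,
    Finset.mem_univ, if_true, ← Finset.smul_sum, Finset.sum_sub_distrib]
  rw [Finset.sum_comm]
  simp only [← Finset.sum_smul, sum_christoffel_conformallyFlatMetric hρ hx]

lemma tension_conformallyFlatMetric (hρ : DifferentiableAt ℝ ρ x) (hx : ρ x ≠ 0) :
    tension (conformallyFlatMetric ρ) h φ x =
      ρ x ^ 2 • (∑ i, covDerivAlong h φ i (pushBasis φ i) x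
        - ∑ k, ((m - 2) * pd k ρ x / ρ x) • pushBasis φ k x) :=
  trace_sub_christoffel_conformallyFlatMetric hρ hx
    (fun i j => covDerivAlong h φ i (pushBasis φ j) x) fun k => pushBasis φ k x

lemma bitension_conformallyFlatMetric (hρ : DifferentiableAt ℝ ρ x) (hx : ρ x ≠ 0) :
    bitension (conformallyFlatMetric ρ) h φ x =
      ρ x ^ 2 • (∑ i, (covDerivAlong h φ i (covDerivAlong h φ i
            (tension (conformallyFlatMetric ρ) h φ)) x
          - curvature h (φ x) (pushBasis φ i x) (tension (conformallyFlatMetric ρ) h φ x)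
            (pushBasis φ i x))
        - ∑ k, ((m - 2) * pd k ρ x / ρ x) •
          covDerivAlong h φ k (tension (conformallyFlatMetric ρ) h φ) x) := by
  rw [← trace_sub_christoffel_conformallyFlatMetric hρ hx (fun i j =>
    covDerivAlong h φ i (covDerivAlong h φ j (tension (conformallyFlatMetric ρ) h φ)) x
      - curvature h (φ x) (pushBasis φ i x) (tension (conformallyFlatMetric ρ) h φ x)
        (pushBasis φ j x))]
  simp only [bitension, sub_right_comm]

lemma meanCurvatureVector_eq_smul_tension (h : MetricField n)
    (φ : (Fin m → ℝ) → (Fin n → ℝ)) (x : Fin m → ℝ) :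
    meanCurvatureVector h φ x = (1 / (m : ℝ)) • tension (pullbackMetric φ h) h φ x :=
  rfl

end ConformallyFlatSource

section Hyperplane

/-- The inclusion `p ↦ (p, a)` of the coordinate hyperplane `xₙ₊₁ = a` of `ℝⁿ⁺¹`. -/
def hyperplaneMap {n : ℕ} (a : ℝ) (p : Fin n → ℝ) : Fin (n + 1) → ℝ :=
  Fin.snoc p a

variable {n : ℕ} {a : ℝ}

@[simp]
lemma hyperplaneMap_castSucc (a : ℝ) (p : Fin n → ℝ) (i : Fin n) :
    hyperplaneMap a p i.castSucc = p i := by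
  simp [hyperplaneMap]

@[simp]
lemma hyperplaneMap_last (a : ℝ) (p : Fin n → ℝ) : hyperplaneMap a p (Fin.last n) = a := by
  simp [hyperplaneMap]

lemma forall_hyperplaneMap_iff {P : (Fin (n + 1) → ℝ) → Prop} :
    (∀ p : Fin n → ℝ, P (hyperplaneMap a p)) ↔ ∀ q, q (Fin.last n) = a → P q := by
  refine ⟨fun h q hq => ?_, fun h p => h _ (hyperplaneMap_last a p)⟩
  have hsnoc : hyperplaneMap a (Fin.init q) = q := by
    rw [hyperplaneMap, ← hq]
    exact Fin.snoc_init_self q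
  exact hsnoc ▸ h (Fin.init q)

lemma planeMap_eq_hyperplaneMap (a : ℝ) : planeMap a = hyperplaneMap a := by
  funext p k
  fin_cases k <;> rfl

lemma contDiff_hyperplaneMap (a : ℝ) : ContDiff ℝ ∞ (hyperplaneMap (n := n) a) := by
  refine contDiff_pi.2 fun k => ?_
  cases k using Fin.lastCases with
  | last => simpa only [hyperplaneMap_last] using contDiff_const
  | cast i => simpa only [hyperplaneMap_castSucc] using contDiff_apply ℝ ℝ i

lemma differentiable_hyperplaneMap (a : ℝ) : Differentiable ℝ (hyperplaneMap (n := n) a) :=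
  (contDiff_hyperplaneMap a).differentiable (by simp)

lemma differentiableAt_comp_hyperplaneMap {G : (Fin (n + 1) → ℝ) → ℝ} {x : Fin n → ℝ}
    (hG : DifferentiableAt ℝ G (hyperplaneMap a x)) :
    DifferentiableAt ℝ (fun p => G (hyperplaneMap a p)) x :=
  hG.comp x (differentiable_hyperplaneMap a x)

lemma fderiv_hyperplaneMap_apply (a : ℝ) (x v : Fin n → ℝ) :
    fderiv ℝ (hyperplaneMap a) x v = hyperplaneMap 0 v := by
  funext k
  refine (DFunLike.congr_fun (fderiv_apply (differentiable_hyperplaneMap a x) k) v).symm.trans ?_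
  cases k using Fin.lastCases with
  | last => simp
  | cast i =>
    simp only [hyperplaneMap_castSucc]
    exact DFunLike.congr_fun (hasFDerivAt_apply i x).fderiv v

lemma injective_fderiv_hyperplaneMap (a : ℝ) (x : Fin n → ℝ) :
    Function.Injective (fderiv ℝ (hyperplaneMap a) x) := by
  intro v w hvw
  funext i
  simpa [fderiv_hyperplaneMap_apply] using congrFun hvw i.castSucc

@[simp]
lemma pushBasis_hyperplaneMap (a : ℝ) (i : Fin n) (x : Fin n → ℝ) :
    pushBasis (hyperplaneMap a) i x = Pi.single i.castSucc 1 := by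
  rw [pushBasis_eq_fderiv (differentiable_hyperplaneMap a x), fderiv_hyperplaneMap_apply]
  funext k
  cases k using Fin.lastCases <;> simp [Pi.single_apply, (Fin.castSucc_ne_last _).symm]

lemma sum_smul_pushBasis_hyperplaneMap (a : ℝ) (x b : Fin n → ℝ) :
    ∑ k, b k • pushBasis (hyperplaneMap a) k x = hyperplaneMap 0 b := by
  funext k
  cases k using Fin.lastCases <;> simp [Pi.single_apply, (Fin.castSucc_ne_last _).symm]

lemma pd_comp_hyperplaneMap {G : (Fin (n + 1) → ℝ) → ℝ} {x : Fin n → ℝ}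
    (hG : DifferentiableAt ℝ G (hyperplaneMap a x)) (i : Fin n) :
    pd i (fun p => G (hyperplaneMap a p)) x = pd i.castSucc G (hyperplaneMap a x) := by
  have hcomp := hG.hasFDerivAt.comp x (differentiable_hyperplaneMap a x).hasFDerivAt
  rw [pd, pd, ← pushBasis_hyperplaneMap a i x,
    pushBasis_eq_fderiv (differentiable_hyperplaneMap a x)]
  exact DFunLike.congr_fun hcomp.fderiv _

end Hyperplane

section HyperplaneInConformallyFlat

/-- The unit normal field `u ∂ₙ₊₁` of the hyperplane `xₙ₊₁ = a` for the metric `u⁻² δ`. -/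
noncomputable def hyperplaneNormal {n : ℕ} (u : (Fin (n + 1) → ℝ) → ℝ) (a : ℝ) (p : Fin n → ℝ) :
    Fin (n + 1) → ℝ :=
  u (hyperplaneMap a p) • Pi.single (Fin.last n) 1

/-- `Ric(ξ, ξ) - |A|²` for the unit normal `ξ = u ∂ₙ₊₁` and the second fundamental form `A` of the
hyperplane `xₙ₊₁ = const`, where the ambient metric is `u⁻² δ`. It is the potential of the Jacobi
operator that governs the normal part of the bitension field. -/
noncomputable def jacobiPotential {n : ℕ} (u : (Fin (n + 1) → ℝ) → ℝ) (q : Fin (n + 1) → ℝ) : ℝ :=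
  ∑ i : Fin n, (u q * pd i.castSucc (pd i.castSucc u) q - n * pd i.castSucc u q ^ 2)
    + n * (u q * pd (Fin.last n) (pd (Fin.last n) u) q - 2 * pd (Fin.last n) u q ^ 2)

variable {n : ℕ} {u : (Fin (n + 1) → ℝ) → ℝ} {a : ℝ} {x : Fin n → ℝ}

lemma pullbackMetric_hyperplaneMap (u : (Fin (n + 1) → ℝ) → ℝ) (a : ℝ) :
    pullbackMetric (hyperplaneMap a) (conformallyFlatMetric u) =
      conformallyFlatMetric fun p => u (hyperplaneMap a p) := by
  funext x
  ext i j
  simp [pullbackMetric, metricInner_conformallyFlatMetric, conformallyFlatMetric_apply,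
    Pi.single_apply, eq_comm]

lemma smul_pullbackMetric_hyperplaneMap {f : (Fin n → ℝ) → ℝ} (hf : ∀ p, 0 < f p)
    (u : (Fin (n + 1) → ℝ) → ℝ) (a : ℝ) :
    (fun p => (f p)⁻¹ • pullbackMetric (hyperplaneMap a) (conformallyFlatMetric u) p) =
      conformallyFlatMetric fun p => √(f p) * u (hyperplaneMap a p) := by
  rw [pullbackMetric_hyperplaneMap]
  funext p
  simp [conformallyFlatMetric, rescaleMetric, smul_smul, mul_pow, Real.sq_sqrt (hf p).le, mul_comm]

lemma isConformalImmersion_hyperplaneMap {f : (Fin n → ℝ) → ℝ} (hf : ContDiff ℝ ∞ f)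
    (hf_pos : ∀ p, 0 < f p) (hu : ContDiff ℝ ∞ u) (hpos : ∀ q, 0 < u q) :
    IsConformalImmersion
      (fun p => (f p)⁻¹ • pullbackMetric (hyperplaneMap a) (conformallyFlatMetric u) p)
      (conformallyFlatMetric u) (hyperplaneMap a) fun p => √(f p) where
  riemannian_source := by
    rw [smul_pullbackMetric_hyperplaneMap hf_pos]
    exact isRiemannian_conformallyFlatMetric
      ((hf.sqrt fun p => (hf_pos p).ne').mul (hu.comp (contDiff_hyperplaneMap a)))
      fun p => mul_pos (Real.sqrt_pos.2 (hf_pos p)) (hpos _)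
  riemannian_target := isRiemannian_conformallyFlatMetric hu hpos
  smooth := contDiff_hyperplaneMap a
  immersion := injective_fderiv_hyperplaneMap a
  factor_pos p := Real.sqrt_pos.2 (hf_pos p)
  conformal p := by rw [Real.sq_sqrt (hf_pos p).le, smul_inv_smul₀ (hf_pos p).ne']

@[simp]
lemma hyperplaneNormal_castSucc (u : (Fin (n + 1) → ℝ) → ℝ) (a : ℝ) (x : Fin n → ℝ) (i : Fin n) :
    hyperplaneNormal u a x i.castSucc = 0 := by
  simp [hyperplaneNormal, Fin.castSucc_ne_last]

@[simp]
lemma hyperplaneNormal_last (u : (Fin (n + 1) → ℝ) → ℝ) (a : ℝ) (x : Fin n → ℝ) :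
    hyperplaneNormal u a x (Fin.last n) = u (hyperplaneMap a x) := by
  simp [hyperplaneNormal]

lemma metricInner_hyperplaneNormal_self (hx : u (hyperplaneMap a x) ≠ 0) :
    metricInner (conformallyFlatMetric u) (hyperplaneMap a x) (hyperplaneNormal u a x)
      (hyperplaneNormal u a x) = 1 := by
  simp only [metricInner_conformallyFlatMetric, Fin.sum_univ_castSucc, hyperplaneNormal_castSucc,
    hyperplaneNormal_last, mul_zero, Finset.sum_const_zero, zero_add]
  field_simp

lemma hyperplaneNormal_ne_zero (hx : u (hyperplaneMap a x) ≠ 0) : hyperplaneNormal u a x ≠ 0 :=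
  smul_ne_zero hx (Pi.single_ne_zero_iff.2 one_ne_zero)

lemma smul_hyperplaneNormal_sub_sum_pushBasis_eq_zero_iff {n : ℕ} {u : (Fin (n + 1) → ℝ) → ℝ}
    {x : Fin n → ℝ} (hx : u (hyperplaneMap a x) ≠ 0) (α : ℝ) (b : Fin n → ℝ) :
    α • hyperplaneNormal u a x - ∑ k, b k • pushBasis (hyperplaneMap a) k x = 0 ↔
      α = 0 ∧ ∀ k, b k = 0 := by
  rw [sum_smul_pushBasis_hyperplaneMap, funext_iff, Fin.forall_fin_succ', and_comm]
  simp [hx]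

lemma isUnitNormal_hyperplaneNormal (hu : ContDiff ℝ ∞ u) (h0 : ∀ q, u q ≠ 0) :
    IsUnitNormal (conformallyFlatMetric u) (hyperplaneMap a) (hyperplaneNormal u a) where
  smooth := (hu.comp (contDiff_hyperplaneMap a)).smul contDiff_const
  normal x i := by
    simp [metricInner_conformallyFlatMetric, Pi.single_apply]
  unit x := metricInner_hyperplaneNormal_self (h0 _)

lemma covDerivAlong_hyperplaneMap_single (hu : DifferentiableAt ℝ u (hyperplaneMap a x))
    (hx : u (hyperplaneMap a x) ≠ 0) (i : Fin n) (c : Fin (n + 1)) :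
    covDerivAlong (conformallyFlatMetric u) (hyperplaneMap a) i (fun _ => Pi.single c 1) x =
      (u (hyperplaneMap a x))⁻¹ • ((if i.castSucc = c then fun k => pd k u (hyperplaneMap a x)
          else 0)
        - pd c u (hyperplaneMap a x) • Pi.single i.castSucc 1
        - pd i.castSucc u (hyperplaneMap a x) • Pi.single c 1) := by
  funext k
  simp only [covDerivAlong, pd_const, pushBasis_hyperplaneMap, Pi.single_apply, mul_ite, mul_one,
    mul_zero, Finset.sum_ite_eq', Finset.mem_univ, if_true, zero_add,
    christoffel_conformallyFlatMetric hu hx, Pi.smul_apply, Pi.sub_apply, smul_eq_mul]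
  split_ifs <;> simp only [Pi.zero_apply, sub_zero] <;> ring

lemma sum_covDerivAlong_pushBasis_hyperplaneMap (hu : DifferentiableAt ℝ u (hyperplaneMap a x))
    (hx : u (hyperplaneMap a x) ≠ 0) :
    ∑ i, covDerivAlong (conformallyFlatMetric u) (hyperplaneMap a) i
        (pushBasis (hyperplaneMap a) i) x =
      (n * pd (Fin.last n) u (hyperplaneMap a x) / u (hyperplaneMap a x) ^ 2) •
          hyperplaneNormal u a x
        + ∑ k : Fin n, ((n - 2) * pd k.castSucc u (hyperplaneMap a x) / u (hyperplaneMap a x)) •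
          pushBasis (hyperplaneMap a) k x := by
  have hbasis : ∀ i, pushBasis (hyperplaneMap (n := n) a) i = fun _ => Pi.single i.castSucc 1 :=
    fun i => funext (pushBasis_hyperplaneMap a i)
  rw [sum_smul_pushBasis_hyperplaneMap]
  simp only [hbasis, covDerivAlong_hyperplaneMap_single hu hx, if_true]
  funext k
  simp only [Finset.sum_apply, Pi.add_apply, Pi.smul_apply, Pi.sub_apply, smul_eq_mul,
    ← Finset.mul_sum, Finset.sum_sub_distrib]
  cases k using Fin.lastCases with
  | last =>
    simp only [ne_eq, (Fin.castSucc_ne_last _).symm, not_false_eq_true, Pi.single_eq_of_ne,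
      mul_zero, Finset.sum_const_zero, sub_zero, Finset.sum_const, Finset.card_univ,
      Fintype.card_fin, nsmul_eq_mul, hyperplaneNormal_last, hyperplaneMap_last, add_zero]
    field_simp
  | cast k =>
    simp only [Pi.single_apply, Fin.castSucc_inj, mul_ite, mul_one, mul_zero, Finset.sum_ite_eq,
      Finset.mem_univ, if_true, Finset.sum_const, Finset.card_univ, Fintype.card_fin,
      nsmul_eq_mul, hyperplaneNormal_castSucc, hyperplaneMap_castSucc, zero_add]
    field_simp
    ring

lemma differentiableAt_hyperplaneNormal (hu : DifferentiableAt ℝ u (hyperplaneMap a x)) :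
    DifferentiableAt ℝ (hyperplaneNormal u a) x :=
  (differentiableAt_comp_hyperplaneMap hu).smul (differentiableAt_const _)

lemma covDerivAlong_hyperplaneNormal (hu : DifferentiableAt ℝ u (hyperplaneMap a x))
    (hx : u (hyperplaneMap a x) ≠ 0) (i : Fin n) :
    covDerivAlong (conformallyFlatMetric u) (hyperplaneMap a) i (hyperplaneNormal u a) x =
      -pd (Fin.last n) u (hyperplaneMap a x) • pushBasis (hyperplaneMap a) i x := by
  change covDerivAlong _ _ i (fun p => u (hyperplaneMap a p) • Pi.single (Fin.last n) 1) x = _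
  rw [covDerivAlong_smul i (differentiableAt_comp_hyperplaneMap hu)
      (differentiableAt_const _), pd_comp_hyperplaneMap hu,
    covDerivAlong_hyperplaneMap_single hu hx, if_neg (Fin.castSucc_ne_last i),
    smul_inv_smul₀ hx, pushBasis_hyperplaneMap]
  module

lemma meanCurvatureVector_hyperplaneMap [NeZero n] (hu : Differentiable ℝ u)
    (hx : u (hyperplaneMap a x) ≠ 0) :
    meanCurvatureVector (conformallyFlatMetric u) (hyperplaneMap a) x =
      pd (Fin.last n) u (hyperplaneMap a x) • hyperplaneNormal u a x := by
  have hn : (n : ℝ) ≠ 0 := NeZero.ne _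
  rw [meanCurvatureVector_eq_smul_tension, pullbackMetric_hyperplaneMap,
    tension_conformallyFlatMetric (differentiableAt_comp_hyperplaneMap (hu _)) hx,
    sum_covDerivAlong_pushBasis_hyperplaneMap (hu _) hx]
  simp only [pd_comp_hyperplaneMap (hu _), add_sub_cancel_right, smul_smul]
  congr 1
  field_simp

lemma meanCurvature_hyperplaneMap [NeZero n] (hu : Differentiable ℝ u)
    (hx : u (hyperplaneMap a x) ≠ 0) :
    meanCurvature (conformallyFlatMetric u) (hyperplaneMap a) (hyperplaneNormal u a) x =
      pd (Fin.last n) u (hyperplaneMap a x) := by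
  have hunit := metricInner_hyperplaneNormal_self hx
  rw [metricInner_conformallyFlatMetric] at hunit
  simp only [meanCurvature, meanCurvatureVector_hyperplaneMap hu hx,
    metricInner_conformallyFlatMetric, Pi.smul_apply, smul_eq_mul, mul_assoc, ← Finset.mul_sum]
  rw [mul_left_comm, hunit, mul_one]

lemma covDerivAlong_covDerivAlong_smul_hyperplaneNormal {S : (Fin n → ℝ) → ℝ}
    (hS : ContDiff ℝ ∞ S) (hu : ContDiff ℝ ∞ u) (h0 : ∀ q, u q ≠ 0) (i : Fin n) :
    covDerivAlong (conformallyFlatMetric u) (hyperplaneMap a) i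
        (covDerivAlong (conformallyFlatMetric u) (hyperplaneMap a) i
          fun p => S p • hyperplaneNormal u a p) x =
      pd i (pd i S) x • hyperplaneNormal u a x
        - (2 * pd i S x * pd (Fin.last n) u (hyperplaneMap a x)
          + S x * pd i.castSucc (pd (Fin.last n) u) (hyperplaneMap a x)) •
          pushBasis (hyperplaneMap a) i x
        - (S x * pd (Fin.last n) u (hyperplaneMap a x)) •
          covDerivAlong (conformallyFlatMetric u) (hyperplaneMap a) i
            (pushBasis (hyperplaneMap a) i) x := by
  have hd : Differentiable ℝ u := hu.differentiable (by simp)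
  have hdS : Differentiable ℝ S := hS.differentiable (by simp)
  have hξ : ∀ p, DifferentiableAt ℝ (hyperplaneNormal u a) p :=
    fun p => differentiableAt_hyperplaneNormal (hd _)
  have he : Differentiable ℝ (pushBasis (hyperplaneMap (n := n) a) i) := by
    rw [funext (pushBasis_hyperplaneMap a i)]
    exact differentiable_const _
  have hfirst : (covDerivAlong (conformallyFlatMetric u) (hyperplaneMap a) i
      fun p => S p • hyperplaneNormal u a p) = fun p => pd i S p • hyperplaneNormal u a p
        - (S p * pd (Fin.last n) u (hyperplaneMap a p)) • pushBasis (hyperplaneMap a) i p := by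
    funext p
    rw [covDerivAlong_smul i (hdS p) (hξ p), covDerivAlong_hyperplaneNormal (hd _) (h0 _)]
    module
  have hdS' := differentiable_pd i hS x
  have hH : DifferentiableAt ℝ (fun p => pd (Fin.last n) u (hyperplaneMap a p)) x :=
    differentiableAt_comp_hyperplaneMap (differentiable_pd _ hu _)
  have hSH : DifferentiableAt ℝ (fun p => S p * pd (Fin.last n) u (hyperplaneMap a p)) x :=
    (hdS x).mul hH
  rw [hfirst, covDerivAlong_sub i (hdS'.fun_smul (hξ x)) (hSH.fun_smul (he x)),
    covDerivAlong_smul i hdS' (hξ x), covDerivAlong_hyperplaneNormal (hd _) (h0 _),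
    covDerivAlong_smul i hSH (he x), pd_mul i (hdS x) hH,
    pd_comp_hyperplaneMap (differentiable_pd _ hu _)]
  module

/- Here `|A|² = n (∂ₙ₊₁ u)²`, so the first coefficient is `-Ric(ξ, ξ) / u²`. -/
lemma sum_curvature_hyperplaneNormal (hu : ContDiff ℝ ∞ u) (h0 : ∀ q, u q ≠ 0) :
    ∑ i, curvature (conformallyFlatMetric u) (hyperplaneMap a x) (pushBasis (hyperplaneMap a) i x)
        (hyperplaneNormal u a x) (pushBasis (hyperplaneMap a) i x) =
      -((jacobiPotential u (hyperplaneMap a x)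
          + n * pd (Fin.last n) u (hyperplaneMap a x) ^ 2) / u (hyperplaneMap a x) ^ 2) •
          hyperplaneNormal u a x
        - ∑ k : Fin n, ((n - 1) * pd k.castSucc (pd (Fin.last n) u) (hyperplaneMap a x)) •
          pushBasis (hyperplaneMap a) k x := by
  have hx := h0 (hyperplaneMap a x)
  rw [sum_smul_pushBasis_hyperplaneMap]
  change ∑ i, curvature _ _ _ (u (hyperplaneMap a x) • Pi.single (Fin.last n) 1) _ = _
  simp only [curvature_smul_middle, pushBasis_hyperplaneMap, curvature_single,
    curvatureComponent_conformallyFlatMetric hu h0, ← Finset.smul_sum]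
  funext k
  simp only [Finset.sum_apply, Pi.smul_apply, Pi.sub_apply, smul_eq_mul, Finset.sum_sub_distrib,
    Finset.sum_add_distrib, ← Finset.sum_div]
  cases k using Fin.lastCases with
  | last =>
    simp only [(Fin.castSucc_ne_last _).symm, if_true, if_false, Finset.sum_const_zero,
      Finset.sum_const, Finset.card_univ, Fintype.card_fin, nsmul_eq_mul, jacobiPotential,
      Fin.sum_univ_castSucc, Finset.sum_sub_distrib, ← Finset.mul_sum, hyperplaneNormal_last,
      hyperplaneMap_last]
    field_simp
    ring
  | cast k =>
    simp only [(Fin.castSucc_ne_last _).symm, Fin.castSucc_ne_last, Fin.castSucc_inj, if_true,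
      if_false, ite_self, Finset.sum_ite_eq, Finset.mem_univ, Finset.sum_const_zero,
      Finset.sum_const, Finset.card_univ, Fintype.card_fin, nsmul_eq_mul,
      pd_comm hu (Fin.last n), hyperplaneNormal_castSucc, hyperplaneMap_castSucc]
    field_simp
    ring

lemma sum_covDerivAlong_covDerivAlong_sub_curvature_smul_hyperplaneNormal {S : (Fin n → ℝ) → ℝ}
    (hS : ContDiff ℝ ∞ S) (hu : ContDiff ℝ ∞ u) (h0 : ∀ q, u q ≠ 0) :
    ∑ i, (covDerivAlong (conformallyFlatMetric u) (hyperplaneMap a) i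
          (covDerivAlong (conformallyFlatMetric u) (hyperplaneMap a) i
            fun p => S p • hyperplaneNormal u a p) x
        - curvature (conformallyFlatMetric u) (hyperplaneMap a x)
          (pushBasis (hyperplaneMap a) i x) (S x • hyperplaneNormal u a x)
          (pushBasis (hyperplaneMap a) i x)) =
      (∑ i, pd i (pd i S) x
          + S x * jacobiPotential u (hyperplaneMap a x) / u (hyperplaneMap a x) ^ 2) •
          hyperplaneNormal u a x
        - ∑ k, (2 * pd (Fin.last n) u (hyperplaneMap a x) * pd k S x) •
          pushBasis (hyperplaneMap a) k x
        + ((n - 2) * S x) • ∑ k : Fin n,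
          (pd k.castSucc (pd (Fin.last n) u) (hyperplaneMap a x)
            - pd (Fin.last n) u (hyperplaneMap a x) * pd k.castSucc u (hyperplaneMap a x)
              / u (hyperplaneMap a x)) • pushBasis (hyperplaneMap a) k x := by
  simp only [Finset.sum_sub_distrib, curvature_smul_middle, ← Finset.smul_sum,
    covDerivAlong_covDerivAlong_smul_hyperplaneNormal hS hu h0,
    sum_curvature_hyperplaneNormal hu h0, ← Finset.sum_smul, sum_smul_pushBasis_hyperplaneMap,
    sum_covDerivAlong_pushBasis_hyperplaneMap (hu.differentiable (by simp) _) (h0 _)]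
  have hx := h0 (hyperplaneMap a x)
  funext k
  cases k using Fin.lastCases with
  | last =>
    simp only [Pi.add_apply, Pi.sub_apply, Pi.smul_apply, smul_eq_mul, hyperplaneNormal_last,
      hyperplaneMap_last]
    field_simp
    ring
  | cast k =>
    simp only [Pi.add_apply, Pi.sub_apply, Pi.smul_apply, smul_eq_mul, hyperplaneNormal_castSucc,
      hyperplaneMap_castSucc]
    field_simp
    ring

end HyperplaneInConformallyFlat

section PlaneInConformallyFlatSpace

lemma exists_abs_two_mul_mul_eq_const_iff {X : Type*} {f H : X → ℝ} (hf : ∀ p, 0 < f p) :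
    (∃ c : ℝ, 0 < c ∧ ∀ p, |2 * f p * H p| = c) ↔
      ∃ c : ℝ, 0 < c ∧ ∀ p, H p ≠ 0 ∧ f p = c / |H p| := by
  have habs : ∀ p, |2 * f p * H p| = 2 * f p * |H p| := fun p => by
    rw [abs_mul, abs_of_pos (mul_pos two_pos (hf p))]
  simp only [habs]
  constructor
  · rintro ⟨c, hc, h⟩
    refine ⟨c / 2, half_pos hc, fun p => ?_⟩
    have hH : H p ≠ 0 := by
      rintro hp
      exact hc.ne' (by rw [← h p, hp, abs_zero, mul_zero])
    refine ⟨hH, (eq_div_iff (abs_ne_zero.2 hH)).2 ?_⟩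
    linarith [h p]
  · rintro ⟨c, hc, h⟩
    refine ⟨2 * c, mul_pos two_pos hc, fun p => ?_⟩
    rw [mul_assoc, (eq_div_iff (abs_ne_zero.2 (h p).1)).1 (h p).2]

lemma jacobiPotential_two (u : (Fin 3 → ℝ) → ℝ) (q : Fin 3 → ℝ) :
    jacobiPotential u q = u q * pd 0 (pd 0 u) q - 2 * pd 0 u q ^ 2
      + u q * pd 1 (pd 1 u) q - 2 * pd 1 u q ^ 2
      + 2 * u q * pd 2 (pd 2 u) q - 4 * pd 2 u q ^ 2 := by
  simp only [jacobiPotential, Fin.sum_univ_two, Nat.cast_ofNat]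
  change u q * pd 0 (pd 0 u) q - 2 * pd 0 u q ^ 2
    + (u q * pd 1 (pd 1 u) q - 2 * pd 1 u q ^ 2)
    + 2 * (u q * pd 2 (pd 2 u) q - 2 * pd 2 u q ^ 2) = _
  ring

variable {u : (Fin 3 → ℝ) → ℝ} {ρ : (Fin 2 → ℝ) → ℝ} {a : ℝ} {x : Fin 2 → ℝ}

lemma tension_hyperplaneMap_two (hu : DifferentiableAt ℝ u (hyperplaneMap a x))
    (hx : u (hyperplaneMap a x) ≠ 0) (hρ : DifferentiableAt ℝ ρ x) (hρx : ρ x ≠ 0) :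
    tension (conformallyFlatMetric ρ) (conformallyFlatMetric u) (hyperplaneMap a) x =
      (2 * ρ x ^ 2 * pd (Fin.last 2) u (hyperplaneMap a x) / u (hyperplaneMap a x) ^ 2) •
        hyperplaneNormal u a x := by
  rw [tension_conformallyFlatMetric hρ hρx, sum_covDerivAlong_pushBasis_hyperplaneMap hu hx]
  simp only [Nat.cast_ofNat, sub_self, zero_mul, zero_div, zero_smul, Finset.sum_const_zero,
    add_zero, sub_zero, smul_smul]
  congr 1
  ring

lemma bitension_hyperplaneMap_two {S : (Fin 2 → ℝ) → ℝ} (hu : ContDiff ℝ ∞ u)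
    (h0 : ∀ q, u q ≠ 0) (hρ : DifferentiableAt ℝ ρ x) (hρx : ρ x ≠ 0) (hS : ContDiff ℝ ∞ S)
    (hτ : tension (conformallyFlatMetric ρ) (conformallyFlatMetric u) (hyperplaneMap a) =
      fun p => S p • hyperplaneNormal u a p) :
    bitension (conformallyFlatMetric ρ) (conformallyFlatMetric u) (hyperplaneMap a) x =
      ρ x ^ 2 • ((∑ i, pd i (pd i S) x
          + S x * jacobiPotential u (hyperplaneMap a x) / u (hyperplaneMap a x) ^ 2) •
          hyperplaneNormal u a x
        - ∑ k, (2 * pd (Fin.last 2) u (hyperplaneMap a x) * pd k S x) •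
          pushBasis (hyperplaneMap a) k x) := by
  rw [bitension_conformallyFlatMetric hρ hρx, hτ,
    sum_covDerivAlong_covDerivAlong_sub_curvature_smul_hyperplaneNormal hS hu h0]
  simp only [Nat.cast_ofNat, sub_self, zero_mul, zero_div, zero_smul, Finset.sum_const_zero,
    add_zero, sub_zero]

lemma bitension_hyperplaneMap_two_eq_zero_iff {S : (Fin 2 → ℝ) → ℝ} (hu : ContDiff ℝ ∞ u)
    (h0 : ∀ q, u q ≠ 0) (hρ : DifferentiableAt ℝ ρ x) (hρx : ρ x ≠ 0) (hS : ContDiff ℝ ∞ S)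
    (hτ : tension (conformallyFlatMetric ρ) (conformallyFlatMetric u) (hyperplaneMap a) =
      fun p => S p • hyperplaneNormal u a p) :
    bitension (conformallyFlatMetric ρ) (conformallyFlatMetric u) (hyperplaneMap a) x = 0 ↔
      ∑ i, pd i (pd i S) x
          + S x * jacobiPotential u (hyperplaneMap a x) / u (hyperplaneMap a x) ^ 2 = 0 ∧
        ∀ k, pd (Fin.last 2) u (hyperplaneMap a x) * pd k S x = 0 := by
  rw [bitension_hyperplaneMap_two hu h0 hρ hρx hS hτ,
    smul_eq_zero_iff_right (pow_ne_zero 2 hρx),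
    smul_hyperplaneNormal_sub_sum_pushBasis_eq_zero_iff (h0 _)]
  simp only [mul_assoc, mul_eq_zero, OfNat.ofNat_ne_zero, false_or]

lemma isProperBiharmonicMap_hyperplaneMap_two_iff {f : (Fin 2 → ℝ) → ℝ} (hu : ContDiff ℝ ∞ u)
    (h0 : ∀ q, u q ≠ 0) (hf : ContDiff ℝ ∞ f) (hf_pos : ∀ p, 0 < f p) :
    IsProperBiharmonicMap
        (fun p => (f p)⁻¹ • pullbackMetric (hyperplaneMap a) (conformallyFlatMetric u) p)
        (conformallyFlatMetric u) (hyperplaneMap a) ↔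
      (∀ p, jacobiPotential u (hyperplaneMap a p) = 0) ∧
        ∃ c : ℝ, 0 < c ∧ ∀ p, |2 * f p * pd (Fin.last 2) u (hyperplaneMap a p)| = c := by
  have hφ := contDiff_hyperplaneMap (n := 2) a
  have hρ : Differentiable ℝ fun p => √(f p) * u (hyperplaneMap a p) :=
    ((hf.sqrt fun p => (hf_pos p).ne').mul (hu.comp hφ)).differentiable (by simp)
  have hρ0 : ∀ p, √(f p) * u (hyperplaneMap a p) ≠ 0 := fun p =>
    mul_ne_zero (Real.sqrt_pos.2 (hf_pos p)).ne' (h0 _)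
  set S : (Fin 2 → ℝ) → ℝ := fun p => 2 * f p * pd (Fin.last 2) u (hyperplaneMap a p) with hS_def
  have hS : ContDiff ℝ ∞ S := (contDiff_const.mul hf).mul ((contDiff_pd _ hu).comp hφ)
  have hτ : tension (conformallyFlatMetric fun p => √(f p) * u (hyperplaneMap a p))
      (conformallyFlatMetric u) (hyperplaneMap a) = fun p => S p • hyperplaneNormal u a p := by
    funext p
    rw [tension_hyperplaneMap_two (hu.differentiable (by simp) _) (h0 _) (hρ p) (hρ0 p), mul_pow,
      Real.sq_sqrt (hf_pos p).le]
    have hp := h0 (hyperplaneMap a p)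
    refine congrArg (· • hyperplaneNormal u a p) ?_
    simp only [hS_def]
    field_simp
  have hH : ∀ p, pd (Fin.last 2) u (hyperplaneMap a p) = 0 ↔ S p = 0 := fun p => by
    simp [hS_def, (hf_pos p).ne']
  have hS_iff := forall_sum_pd_pd_add_mul_eq_zero_and_exists_ne_zero_iff hS
    fun p => jacobiPotential u (hyperplaneMap a p) / u (hyperplaneMap a p) ^ 2
  simp only [mul_eq_zero, div_eq_zero_iff, pow_eq_zero_iff two_ne_zero, h0, or_false,
    ← mul_div_assoc] at hS_iff
  rw [smul_pullbackMetric_hyperplaneMap hf_pos]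
  simpa only [IsProperBiharmonicMap, IsBiharmonicMap, IsHarmonicMap, hφ, true_and, hτ,
    bitension_hyperplaneMap_two_eq_zero_iff hu h0 (hρ _) (hρ0 _) hS hτ, smul_eq_zero,
    hyperplaneNormal_ne_zero (h0 _), or_false, not_forall, mul_eq_zero, hH] using hS_iff

end PlaneInConformallyFlatSpace

theorem mainTheorem11 (F β : (Fin 3 → ℝ) → ℝ) (f : (Fin 2 → ℝ) → ℝ) (a₃ : ℝ)
    (hF : ContDiff ℝ ∞ F) (hF_pos : ∀ q, 0 < F q)
    (hβ : ContDiff ℝ ∞ β) (hβ_pos : ∀ q, 0 < β q)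
    (hf : ContDiff ℝ ∞ f) (hf_pos : ∀ p, 0 < f p)
    (h₀ h : MetricField 3) (gbar : MetricField 2) (u : (Fin 3 → ℝ) → ℝ)
    (φ : (Fin 2 → ℝ) → (Fin 3 → ℝ))
    (hh₀ : h₀ = rescaleMetric F (euclideanMetric 3))
    (hh : h = rescaleMetric β h₀)
    (hφ : φ = planeMap a₃)
    (hgbar : gbar = fun p => (f p)⁻¹ • pullbackMetric φ h p)
    (hu : u = fun q => F q * β q) :
    -- the immersion is conformal with conformal factor `√f`
    IsConformalImmersion gbar h φ (fun p => Real.sqrt (f p)) ∧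
    -- the characterization of proper biharmonicity
    (IsProperBiharmonicMap gbar h φ ↔
      (∀ q : Fin 3 → ℝ, q 2 = a₃ →
        u q * pd 0 (pd 0 u) q - 2 * (pd 0 u q) ^ 2
          + u q * pd 1 (pd 1 u) q - 2 * (pd 1 u q) ^ 2
          + 2 * u q * pd 2 (pd 2 u) q - 4 * (pd 2 u q) ^ 2 = 0) ∧
      ∃ c : ℝ, 0 < c ∧ ∀ p, pd 2 u (φ p) ≠ 0 ∧ f p = c / |pd 2 u (φ p)|) ∧
    -- the mean curvature of the surface with respect to the unit normal field `Fβ ∂/∂z`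
    IsUnitNormal h φ (fun p => u (φ p) • Pi.single 2 1) ∧
    (∀ p, meanCurvature h φ (fun p => u (φ p) • Pi.single 2 1) p = pd 2 u (φ p)) ∧
    (∀ p, meanCurvatureVector h φ p = pd 2 u (φ p) • u (φ p) • Pi.single 2 1) := by
  subst hh₀ hh hφ hgbar hu
  simp only [planeMap_eq_hyperplaneMap, rescaleMetric_rescaleMetric_euclideanMetric]
  set u : (Fin 3 → ℝ) → ℝ := fun q => F q * β q
  have hu : ContDiff ℝ ∞ u := hF.mul hβ
  have hu_pos : ∀ q, 0 < u q := fun q => mul_pos (hF_pos q) (hβ_pos q)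
  have hu_ne : ∀ q, u q ≠ 0 := fun q => (hu_pos q).ne'
  have hu_diff : Differentiable ℝ u := hu.differentiable (by simp)
  refine ⟨isConformalImmersion_hyperplaneMap hf hf_pos hu hu_pos, ?_,
    isUnitNormal_hyperplaneNormal hu hu_ne,
    fun p => meanCurvature_hyperplaneMap hu_diff (hu_ne _),
    fun p => meanCurvatureVector_hyperplaneMap hu_diff (hu_ne _)⟩
  rw [isProperBiharmonicMap_hyperplaneMap_two_iff hu hu_ne hf hf_pos,
    exists_abs_two_mul_mul_eq_const_iff hf_pos,
    forall_hyperplaneMap_iff (P := fun q => jacobiPotential u q = 0)]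
  simp only [jacobiPotential_two]
  rfl
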